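/- Let $p$ be an odd prime and let $D_{2p}=\langle \tau,\sigma\mid \tau^p=\sigma^2=e,\ \sigma\tau\sigma=\tau^{-1}\rangle$ be the dihedral group of order $2p$. For a finite group $G$ and a subset $S\subseteq G$ with $e\notin S$, the Cayley digraph $\mathrm{Cay}(G,S)$ has vertex set $G$ and an arc from $g$ to $h$ if and only if $hg^{-1}\in S$; a digraph is called connected if its underlying undirected graph is connected. Put $$\mathcal N=\frac1p\,2^{p}\bigl(1-2^{p-1}\bigr)+\frac{2}{p-1}\sum_{d\mid (p-1)}\varphi(d)\,2^{2(p-1)/d},\qquad \mathcal N_c=\frac{1}{p-1}\sum_{d\mid (p-1)}\varphi(d)\,2^{(p-1)/d},$$ where $\varphi$ is Euler's totient function. Then the number of connected Cayley digraphs on $D_{2p}$ up to isomorphism is equal to $$\mathcal N-\mathcal N_c-1.$$ Moreover, $\mathcal N$ is the number of all Cayley digraphs on $D_{2p}$ up to isomorphism, and $\mathcal N_c$ is the number of circulant digraphs of order $p$ (Cayley digraphs on the cyclic group of order $p$) up to isomorphism. -/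

import Mathlib

namespace CayleyEnum

/-- The Cayley digraph `Cay(G, S)`: vertex set `G`, with an arc from `g` to `h` iff `h g⁻¹ ∈ S`. -/
def Cay {G : Type*} [Group G] (S : Set G) : Digraph G where
  Adj g h := h * g⁻¹ ∈ S

/-- The set of all Cayley digraphs on `G`, that is, of all `Cay(G, S)` with `1 ∉ S ⊆ G`. -/
def cayleyDigraphs (G : Type*) [Group G] : Set (Digraph G) :=
  {X | ∃ S : Set G, (1 : G) ∉ S ∧ X = Cay S}

/-- A digraph is connected if its underlying undirected graph is connected. -/
def IsConnected {V : Type*} (X : Digraph V) : Prop :=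
  X.toSimpleGraphInclusive.Connected

/-- Isomorphism of digraphs on a vertex type `V`: there is a bijection of the vertices that
preserves and reflects arcs. -/
def isoSetoid (V : Type*) : Setoid (Digraph V) where
  r X Y := Nonempty (X.Adj ≃r Y.Adj)
  iseqv :=
    { refl := fun X => ⟨RelIso.refl X.Adj⟩
      symm := fun ⟨e⟩ => ⟨e.symm⟩
      trans := fun ⟨e⟩ ⟨f⟩ => ⟨e.trans f⟩ }

/-- The number of members of a set of digraphs on `V`, up to isomorphism. -/
noncomputable def countUpToIso {V : Type*} (𝒳 : Set (Digraph V)) : ℕ :=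
  (Quotient.mk (isoSetoid V) '' 𝒳).ncard

/-- `N = (1/p) 2^p (1 - 2^(p-1)) + (2/(p-1)) ∑_{d ∣ p-1} φ(d) 2^(2(p-1)/d)`. -/
def totalN (p : ℕ) : ℚ :=
  1 / (p : ℚ) * 2 ^ p * (1 - 2 ^ (p - 1)) +
    2 / ((p : ℚ) - 1) * ∑ d ∈ (p - 1).divisors, (Nat.totient d : ℚ) * 2 ^ (2 * (p - 1) / d)

/-- `N_c = (1/(p-1)) ∑_{d ∣ p-1} φ(d) 2^((p-1)/d)`. -/
def circulantN (p : ℕ) : ℚ :=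
  1 / ((p : ℚ) - 1) * ∑ d ∈ (p - 1).divisors, (Nat.totient d : ℚ) * 2 ^ ((p - 1) / d)

end CayleyEnum

/-! On D_{2p} and on C_p, isomorphic Cayley digraphs already differ by a group automorphism, so the
counts are orbit counts, given by Burnside's lemma.

The reason is Sylow theory. As p³ divides neither (2p)! nor p!, Sylow p-subgroups of Aut Cay(G, T)
are abelian. Hence an isomorphism Cay(G, S) → Cay(G, T) can be corrected by an automorphism until it
carries right translation by an element z of order p to a permutation commuting with that
translation (`exists_normalized_iso`). In D_{2p} it is then affine on the rotations and on the
reflections, with slopes i and j. If i = j it is a group automorphism; if i ≠ j, each connection set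
contains all reflections or none, and any automorphism of slope i does the job.

A connection set is a pair (A, B) with A ⊆ (ℤ/p)ˣ, B ⊆ ℤ/p, and Aut D_{2p} acts as the affine group:
by slopes on A, by affine maps on B. The disconnected classes are those with B = ∅, counted as
circulants, and the single class of one reflection. -/

open scoped Pointwise

/-! ### Sylow argument and normalised isomorphisms -/

/-- Two elements of order `p` of a finite group commute after conjugating one of them, provided
that `p ^ 3` does not divide the order of the group. -/
theorem Group.exists_commute_conj {A : Type*} [Group A] [Finite A] {p : ℕ} [Fact p.Prime]
    (hA : ¬ p ^ 3 ∣ Nat.card A) {x y : A} (hx : orderOf x = p) (hy : orderOf y = p) :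
    ∃ a : A, Commute x (a * y * a⁻¹) := by
  obtain ⟨Q, hQ⟩ := (IsPGroup.of_card (p := p) (n := 1)
    (by rw [Nat.card_zpowers, hx, pow_one]) : IsPGroup p (Subgroup.zpowers x)).exists_le_sylow
  obtain ⟨Q', hQ'⟩ := (IsPGroup.of_card (p := p) (n := 1)
    (by rw [Nat.card_zpowers, hy, pow_one]) : IsPGroup p (Subgroup.zpowers y)).exists_le_sylow
  obtain ⟨a, ha⟩ := MulAction.exists_smul_eq A Q' Q
  refine ⟨a, ?_⟩
  have hxQ : x ∈ (Q : Subgroup A) := hQ (Subgroup.mem_zpowers x)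
  have hyQ : a * y * a⁻¹ ∈ (Q : Subgroup A) := by
    rw [← ha, Sylow.coe_subgroup_smul, ← MulAut.conj_apply]
    exact Subgroup.smul_mem_pointwise_smul _ _ _ (hQ' (Subgroup.mem_zpowers y))
  obtain ⟨n, hn⟩ := IsPGroup.iff_card.mp Q.isPGroup'
  -- The Sylow subgroup has order 1, p or p², hence is abelian.
  have hn3 : n < 3 := by
    by_contra! h
    exact hA ((pow_dvd_pow p h).trans (hn ▸ Subgroup.card_subgroup_dvd_card (Q : Subgroup A)))
  have hc : ∀ u v : (Q : Subgroup A), u * v = v * u := by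
    interval_cases n
    · have : Subsingleton (Q : Subgroup A) := (Nat.card_eq_one_iff_unique.mp (by simpa using hn)).1
      exact fun u v => Subsingleton.elim _ _
    · have : IsCyclic (Q : Subgroup A) := isCyclic_of_prime_card (p := p) (by simpa using hn)
      exact (IsCyclic.isMulCommutative (α := (Q : Subgroup A))).is_comm.comm
    · exact (IsPGroup.isMulCommutative_of_card_eq_prime_sq hn).is_comm.comm
  exact congrArg Subtype.val (hc ⟨x, hxQ⟩ ⟨_, hyQ⟩)

namespace CayleyEnum

/-- The automorphism group of a digraph. -/
def autGroup {V : Type*} (X : Digraph V) : Subgroup (Equiv.Perm V) where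
  carrier := {a | ∀ g h, X.Adj (a g) (a h) ↔ X.Adj g h}
  mul_mem' ha hb g h := (ha _ _).trans (hb g h)
  one_mem' _ _ := Iff.rfl
  inv_mem' {a} ha g h := by simpa using (ha (a⁻¹ g) (a⁻¹ h)).symm

variable {G : Type*} [Group G]

theorem mulRight_mem_autGroup (S : Set G) (z : G) : Equiv.mulRight z ∈ autGroup (Cay S) := by
  intro g h
  simp [Cay, mul_assoc]

theorem orderOf_mulRight (z : G) : orderOf (Equiv.mulRight z) = orderOf z := by
  refine orderOf_eq_orderOf_iff.mpr fun n => ?_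
  rw [Equiv.pow_mulRight]
  constructor
  · intro h
    simpa using congrArg (fun e : Equiv.Perm G => e 1) h
  · intro h
    rw [h]
    exact Equiv.ext fun x => mul_one x

/-- An isomorphism between two Cayley digraphs can be changed into one which fixes the identity and
conjugates the right translation by `z` into a permutation `σ` commuting with it, when `z`
generates a normal subgroup of prime order `p` and `p ^ 3` does not divide `|G|!`. -/
theorem exists_normalized_iso [Finite G] {p : ℕ} [Fact p.Prime]
    (hG : ¬ p ^ 3 ∣ (Nat.card G).factorial) {z : G} (hz : orderOf z = p)
    (hn : (Subgroup.zpowers z).Normal) {S T : Set G}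
    (e : Nonempty ((Cay S).Adj ≃r (Cay T).Adj)) :
    ∃ f σ : Equiv.Perm G, f 1 = 1 ∧ (∀ g h, (Cay T).Adj (f g) (f h) ↔ (Cay S).Adj g h) ∧
      σ ^ p = 1 ∧ (∀ x, f (x * z) = σ (f x)) ∧ (∀ x, σ (x * z) = σ x * z) := by
  obtain ⟨e⟩ := e
  have he : ∀ g h, (Cay T).Adj (e.toEquiv g) (e.toEquiv h) ↔ (Cay S).Adj g h :=
    fun g h => e.map_rel_iff
  set ε : Equiv.Perm G := e.toEquiv
  set ρ : Equiv.Perm G := Equiv.mulRight z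
  have hρ' : ε * ρ * ε⁻¹ ∈ autGroup (Cay T) := by
    intro g h
    have h1 := mulRight_mem_autGroup S z (ε⁻¹ g) (ε⁻¹ h)
    simp only [Equiv.Perm.mul_apply]
    rw [he, h1, ← he]
    simp
  have hord : orderOf (ε * ρ * ε⁻¹) = p := by
    rw [← MulAut.conj_apply, MulEquiv.orderOf_eq, orderOf_mulRight, hz]
  have hcard : ¬ p ^ 3 ∣ Nat.card (autGroup (Cay T)) := fun h => hG <| by
    rw [← Nat.card_perm]
    exact h.trans (Subgroup.card_subgroup_dvd_card _)
  obtain ⟨⟨a, ha⟩, hcomm⟩ := Group.exists_commute_conj hcard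
    (x := ⟨ρ, mulRight_mem_autGroup T z⟩) (y := ⟨_, hρ'⟩)
    (by rw [Subgroup.orderOf_mk, orderOf_mulRight, hz]) (by rw [Subgroup.orderOf_mk, hord])
  replace hcomm : Commute ρ (a * (ε * ρ * ε⁻¹) * a⁻¹) := congrArg Subtype.val hcomm
  -- The translation `c` brings the image of 1 back to 1. Since `z` generates a normal subgroup,
  -- conjugation by `c` maps ρ to a power of ρ, so commutation survives.
  set c : Equiv.Perm G := Equiv.mulRight (a (ε 1))⁻¹
  set σ₁ := a * (ε * ρ * ε⁻¹) * a⁻¹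
  have hcρ : Commute (c⁻¹ * ρ * c) σ₁ := by
    obtain ⟨k, hk⟩ := Subgroup.mem_zpowers_iff.mp
      (hn.conj_mem z (Subgroup.mem_zpowers z) (a (ε 1))⁻¹)
    have : c⁻¹ * ρ * c = ρ ^ k := by
      ext x
      rw [Equiv.zpow_mulRight, hk]
      simp [c, ρ, mul_assoc]
    rw [this]
    exact hcomm.zpow_left k
  refine ⟨c * a * ε, c * σ₁ * c⁻¹, by simp [c], fun g h => ?_, ?_, fun x => ?_, fun x => ?_⟩
  · exact (mulRight_mem_autGroup T _ _ _).trans ((ha _ _).trans (he g h))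
  · have : σ₁ = (a * ε) * ρ * (a * ε)⁻¹ := by simp [σ₁, mul_assoc]
    rw [conj_pow, this, conj_pow, ← hz, ← orderOf_mulRight z, pow_orderOf_eq_one]
    simp
  · simp [σ₁, ρ]
  · have : Commute ρ (c * σ₁ * c⁻¹) := by
      have h := congrArg (fun t => c * t * c⁻¹) hcρ.eq
      simpa [Commute, SemiconjBy, mul_assoc] using h
    exact (congrArg (fun t : Equiv.Perm G => t x) this.eq).symm

/-! ### Group automorphisms and connectivity -/

/-- A group automorphism induces isomorphisms of Cayley digraphs. -/
theorem nonempty_relIso_of_mulEquiv (φ : G ≃* G) {S T : Set G} (h : ∀ g, φ g ∈ T ↔ g ∈ S) :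
    Nonempty ((Cay S).Adj ≃r (Cay T).Adj) :=
  ⟨⟨φ.toEquiv, fun {g k} => by simp [Cay, ← map_inv, ← map_mul, h]⟩⟩

/-- The Cayley digraph `Cay(G, S)` is connected iff `S` generates `G`. -/
theorem isConnected_Cay_iff {S : Set G} (hS : (1 : G) ∉ S) :
    IsConnected (Cay S) ↔ Subgroup.closure S = ⊤ := by
  have hadj : ∀ g h, (Cay S).toSimpleGraphInclusive.Adj g h ↔
      g ≠ h ∧ (h * g⁻¹ ∈ S ∨ g * h⁻¹ ∈ S) := fun g h => Iff.rfl
  constructor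
  · intro hc
    rw [eq_top_iff]
    intro g _
    obtain ⟨w⟩ := hc.preconnected g 1
    suffices ∀ u v : G, (Cay S).toSimpleGraphInclusive.Walk u v →
        v ∈ Subgroup.closure S → u ∈ Subgroup.closure S from this g 1 w (one_mem _)
    intro u v w
    induction w with
    | nil => exact id
    | @cons u v w h _ ih =>
      intro hw
      have hv := ih hw
      obtain ⟨-, h | h⟩ := (hadj _ _).mp h
      · have := mul_mem (inv_mem (Subgroup.subset_closure h)) hv
        simpa using this
      · have := mul_mem (Subgroup.subset_closure h) hv
        simpa using this
  · intro hcl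
    have hright : ∀ x u v : G, (Cay S).toSimpleGraphInclusive.Reachable u v →
        (Cay S).toSimpleGraphInclusive.Reachable (u * x) (v * x) := by
      intro x u v huv
      refine huv.map ⟨(· * x), fun {g h} hgh => ?_⟩
      rw [hadj] at hgh ⊢
      simpa using hgh
    -- Right translations are graph automorphisms, so the component of 1 is a subgroup.
    let H : Subgroup G :=
      { carrier := {g | (Cay S).toSimpleGraphInclusive.Reachable 1 g}
        one_mem' := SimpleGraph.Reachable.refl _
        mul_mem' := fun {g h} hg hh => hh.trans (by simpa using hright h 1 g hg)
        inv_mem' := fun {g} hg => by simpa using (hright g⁻¹ 1 g hg).symm }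
    have hH : H = ⊤ := by
      rw [eq_top_iff, ← hcl, Subgroup.closure_le]
      intro s hs
      refine SimpleGraph.Adj.reachable ((hadj _ _).mpr ⟨?_, by simpa using Or.inl hs⟩)
      rintro rfl
      exact hS hs
    have hall : ∀ g : G, (Cay S).toSimpleGraphInclusive.Reachable 1 g := fun g =>
      (hH ▸ Subgroup.mem_top g : g ∈ H)
    exact { preconnected := fun u v => (hall u).symm.trans (hall v), nonempty := ⟨1⟩ }

/-- Connectivity is invariant under isomorphism. -/
theorem IsConnected.of_relIso {V : Type*} {X Y : Digraph V} (e : X.Adj ≃r Y.Adj)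
    (h : IsConnected X) : IsConnected Y := by
  let f : X.toSimpleGraphInclusive ≃g Y.toSimpleGraphInclusive :=
    ⟨e.toEquiv, fun {a b} => by
      change (e a ≠ e b ∧ (Y.Adj (e a) (e b) ∨ Y.Adj (e b) (e a))) ↔
        (a ≠ b ∧ (X.Adj a b ∨ X.Adj b a))
      rw [e.map_rel_iff, e.map_rel_iff, e.injective.ne_iff]⟩
  exact f.connected_iff.mp h

/-! ### Orbit counting -/

/-- Counting the values of a family of digraphs up to isomorphism. -/
theorem countUpToIso_range {V β : Type*} [Finite β] (c : β → Digraph V) (s : Setoid β)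
    (hc : ∀ x y, Nonempty ((c x).Adj ≃r (c y).Adj) ↔ s x y) :
    countUpToIso (Set.range c) = Nat.card (Quotient s) := by
  let f : Quotient s → Quotient (isoSetoid V) :=
    Quotient.map' c fun x y h => (hc x y).mpr h
  have hf : Function.Injective f := by
    rintro ⟨x⟩ ⟨y⟩ h
    exact Quotient.sound ((hc x y).mp (Quotient.exact h))
  have hr : Quotient.mk (isoSetoid V) '' Set.range c = Set.range f := by
    ext q
    constructor
    · rintro ⟨_, ⟨x, rfl⟩, rfl⟩
      exact ⟨Quotient.mk s x, rfl⟩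
    · rintro ⟨⟨x⟩, rfl⟩
      exact ⟨c x, ⟨x, rfl⟩, rfl⟩
  rw [countUpToIso, hr, ← Nat.card_coe_set_eq, Nat.card_range_of_injective hf]

/-- Burnside's lemma for finite types. -/
theorem sum_card_fixedBy (H β : Type*) [Group H] [Fintype H] [Finite β] [MulAction H β] :
    ∑ h : H, Nat.card (MulAction.fixedBy β h) =
      Nat.card (Quotient (MulAction.orbitRel H β)) * Nat.card H := by
  classical
  have := Fintype.ofFinite β
  have := Fintype.ofFinite (Quotient (MulAction.orbitRel H β))
  simp only [Nat.card_eq_fintype_card]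
  exact MulAction.sum_card_fixedBy_eq_card_orbits_mul_card_group H β

/-- The number of subsets of a group which are invariant under translation by `a`. -/
theorem card_fixedBy_set (H : Type*) [Group H] [Finite H] (a : H) :
    Nat.card (MulAction.fixedBy (Set H) a) = 2 ^ (Nat.card H / orderOf a) := by
  have hfix : ∀ s : Set H, a • s = s → ∀ k : ℤ, ∀ x, a ^ k * x ∈ s ↔ x ∈ s := by
    intro s hs k x
    have : a ^ k ∈ MulAction.stabilizer H s := zpow_mem (MulAction.mem_stabilizer_iff.mpr hs) k
    nth_rewrite 1 [← MulAction.mem_stabilizer_iff.mp this]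
    exact Set.smul_mem_smul_set_iff
  let r := MulAction.orbitRel (Subgroup.zpowers a) H
  -- An invariant set is a union of cosets ⟨a⟩x.
  have e : MulAction.fixedBy (Set H) a ≃ Set (Quotient r) :=
    { toFun := fun s => {q | Quotient.liftOn q (· ∈ s.1) (by
        rintro _ x ⟨⟨_, k, rfl⟩, rfl⟩
        exact propext (hfix s.1 s.2 k x))}
      invFun := fun t => ⟨{x | Quotient.mk r x ∈ t}, by
        rw [MulAction.mem_fixedBy]
        ext x
        rw [Set.mem_smul_set_iff_inv_smul_mem]
        have : Quotient.mk r (a⁻¹ • x) = Quotient.mk r x :=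
          Quotient.sound ⟨⟨a⁻¹, inv_mem (Subgroup.mem_zpowers a)⟩, rfl⟩
        change Quotient.mk r (a⁻¹ • x) ∈ t ↔ Quotient.mk r x ∈ t
        rw [this]⟩
      left_inv := fun s => rfl
      right_inv := fun t => by
        ext ⟨x⟩
        rfl }
  have hq : Nat.card (Quotient r) = Nat.card H / orderOf a := by
    rw [← Nat.card_zpowers, ← Subgroup.index_mul_card (Subgroup.zpowers a),
      Nat.mul_div_cancel _ Nat.card_pos, Subgroup.index]
    exact Nat.card_congr (QuotientGroup.quotientRightRelEquivQuotientLeftRel _)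
  rw [Nat.card_congr e, ← hq]
  have := Fintype.ofFinite (Quotient r)
  simp [Nat.card_eq_fintype_card]

/-- Summing a function of the order over a finite cyclic group. -/
theorem sum_orderOf_eq {H : Type*} [Group H] [Fintype H] [IsCyclic H] (F : ℕ → ℚ) :
    ∑ a : H, F (orderOf a) = ∑ d ∈ (Nat.card H).divisors, (d.totient : ℚ) * F d := by
  rw [← Finset.sum_fiberwise_of_maps_to (s := Finset.univ) (t := (Nat.card H).divisors)
    (g := fun a : H => orderOf a)
    (fun a _ => Nat.mem_divisors.mpr ⟨orderOf_dvd_natCard a, Nat.card_pos.ne'⟩)]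
  refine Finset.sum_congr rfl fun d hd => ?_
  rw [Finset.sum_congr rfl (g := fun _ => F d) fun a ha => by rw [(Finset.mem_filter.mp ha).2],
    Finset.sum_const, nsmul_eq_mul, IsCyclic.card_orderOf_eq_totient
      (by rw [← Nat.card_eq_fintype_card]; exact Nat.dvd_of_mem_divisors hd)]

/-- The group of affine maps `x ↦ a x + b` of a commutative ring. -/
@[ext]
structure AffineMaps (R : Type*) [CommRing R] where
  /-- the slope -/
  slope : Rˣ
  /-- the value at zero -/
  shift : R

namespace AffineMaps

variable {R : Type*} [CommRing R]

instance : Mul (AffineMaps R) := ⟨fun g h => ⟨g.slope * h.slope, g.slope * h.shift + g.shift⟩⟩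
instance : One (AffineMaps R) := ⟨⟨1, 0⟩⟩
instance : Inv (AffineMaps R) := ⟨fun g => ⟨g.slope⁻¹, -(↑g.slope⁻¹ * g.shift)⟩⟩

theorem mul_def (g h : AffineMaps R) :
    g * h = ⟨g.slope * h.slope, g.slope * h.shift + g.shift⟩ := rfl
theorem one_def : (1 : AffineMaps R) = ⟨1, 0⟩ := rfl
theorem inv_def (g : AffineMaps R) : g⁻¹ = ⟨g.slope⁻¹, -(↑g.slope⁻¹ * g.shift)⟩ := rfl

instance : Group (AffineMaps R) :=
  Group.ofLeftAxioms
    (fun a b c => by ext <;> simp [mul_def, mul_assoc]; ring)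
    (fun a => by ext <;> simp [mul_def, one_def])
    (fun a => by ext <;> simp [mul_def, one_def, inv_def])

instance : MulAction (AffineMaps R) R where
  smul g x := g.slope * x + g.shift
  one_smul x := by change ((1 : Rˣ) : R) * x + 0 = x; simp
  mul_smul g h x := by
    change ((g.slope * h.slope : Rˣ) : R) * x + (g.slope * h.shift + g.shift) =
      g.slope * (h.slope * x + h.shift) + g.shift
    push_cast
    ring

/-- Shifts act trivially here because the automorphism of D_{2p} attached to an affine map only
multiplies rotation exponents by the slope. -/
instance : MulAction (AffineMaps R) Rˣ where
  smul g u := g.slope * u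
  one_smul u := one_mul u
  mul_smul g h u := mul_assoc g.slope h.slope u

theorem smul_def (g : AffineMaps R) (x : R) : g • x = g.slope * x + g.shift := rfl
theorem smul_units_def (g : AffineMaps R) (u : Rˣ) : g • u = g.slope * u := rfl

/-- An affine map is given by its slope and shift. -/
def equivProd : AffineMaps R ≃ Rˣ × R where
  toFun g := (g.slope, g.shift)
  invFun x := ⟨x.1, x.2⟩
  left_inv _ := rfl
  right_inv _ := rfl

end AffineMaps

variable {p : ℕ} [Fact p.Prime]

/-- Sets of residues invariant under a nontrivial homothety. -/
theorem card_fixedBy_homothety {g : AffineMaps (ZMod p)} (hg : g.slope ≠ 1) :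
    Nat.card (MulAction.fixedBy (Set (ZMod p)) g) =
      2 * Nat.card (MulAction.fixedBy (Set (ZMod p)ˣ) g.slope) := by
  have h1 : (1 - g.slope : ZMod p) ≠ 0 := fun h => hg (Units.ext (sub_eq_zero.mp h).symm)
  -- With the fixed point `c` as origin, g is multiplication by its slope. An invariant set is thus
  -- a free choice at `c` and an invariant set of units.
  obtain ⟨c, hc⟩ : ∃ c : ZMod p, g • c = c := ⟨g.shift / (1 - g.slope), by
    rw [AffineMaps.smul_def]; field_simp; ring⟩
  have hgu : ∀ u : (ZMod p)ˣ, g • (c + u : ZMod p) = c + ((g.slope * u : (ZMod p)ˣ) : ZMod p) := by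
    intro u
    nth_rewrite 2 [← hc]
    simp only [AffineMaps.smul_def]
    push_cast
    ring
  have hfix : ∀ (Y : Type) [MulAction (AffineMaps (ZMod p)) Y] (B : Set Y),
      g • B = B ↔ ∀ x, g • x ∈ B ↔ x ∈ B := by
    intro Y _ B
    constructor
    · intro h x
      nth_rewrite 1 [← h]
      exact Set.smul_mem_smul_set_iff
    · intro h
      ext x
      rw [Set.mem_smul_set_iff_inv_smul_mem, ← h, smul_inv_smul]
  have e : MulAction.fixedBy (Set (ZMod p)) g ≃
      Prop × MulAction.fixedBy (Set (ZMod p)ˣ) g.slope :=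
    { toFun := fun B => (c ∈ B.1, ⟨{u | c + (u : ZMod p) ∈ B.1}, by
        have hB := (hfix _ B.1).mp B.2
        refine (hfix _ _).mpr fun u => ?_
        change c + ((g.slope * u : (ZMod p)ˣ) : ZMod p) ∈ B.1 ↔ c + (u : ZMod p) ∈ B.1
        rw [← hgu, hB]⟩)
      invFun := fun x => ⟨{y | (y = c ∧ x.1) ∨ ∃ u ∈ x.2.1, y = c + (u : ZMod p)}, by
        have hA := (hfix _ x.2.1).mp x.2.2
        refine (hfix _ _).mpr fun y => ?_
        have h2 : g • y = c ↔ y = c := by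
          nth_rewrite 1 [← hc]
          exact smul_left_cancel_iff g
        have h3 : (∃ u ∈ x.2.1, g • y = c + (u : ZMod p)) ↔ ∃ u ∈ x.2.1, y = c + (u : ZMod p) := by
          constructor
          · rintro ⟨u, hu, hy⟩
            refine ⟨g⁻¹ • u, by rwa [← hA, smul_inv_smul], ?_⟩
            rw [← smul_left_cancel_iff g, hy, hgu]
            exact congrArg (fun v : (ZMod p)ˣ => c + (v : ZMod p)) (smul_inv_smul g u).symm
          · rintro ⟨u, hu, rfl⟩
            exact ⟨g • u, (hA u).mpr hu, hgu u⟩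
        simp only [Set.mem_ofPred_eq, h2, h3]⟩
      left_inv := fun B => by
        ext y
        simp only [Set.mem_ofPred_eq]
        constructor
        · rintro (⟨rfl, h⟩ | ⟨u, h, rfl⟩)
          exacts [h, h]
        · intro h
          by_cases hy : y = c
          · exact Or.inl ⟨hy, hy ▸ h⟩
          · exact Or.inr ⟨Units.mk0 (y - c) (sub_ne_zero.mpr hy), by simpa using h, by simp⟩
      right_inv := fun x => by
        refine Prod.ext ?_ (Subtype.ext ?_)
        · simp
        · ext u
          simp [Units.val_inj] }
  rw [Nat.card_congr e, Nat.card_prod]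
  simp

/-- Sets of residues invariant under a nontrivial translation. -/
theorem card_fixedBy_translation {g : AffineMaps (ZMod p)} (hg : g.slope = 1) (hs : g.shift ≠ 0) :
    Nat.card (MulAction.fixedBy (Set (ZMod p)) g) = 2 := by
  have hgx : ∀ x : ZMod p, g • x = x + g.shift := fun x => by simp [AffineMaps.smul_def, hg]
  have : MulAction.fixedBy (Set (ZMod p)) g = {∅, Set.univ} := by
    ext B
    simp only [MulAction.mem_fixedBy, Set.mem_insert_iff, Set.mem_singleton_iff]
    constructor
    · intro h
      by_contra! hne
      obtain ⟨⟨x, hx⟩, hu⟩ := hne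
      refine hu (Set.eq_univ_of_forall fun y => ?_)
      -- Multiples of a nonzero shift exhaust ℤ/p.
      have hn : ∀ n : ℕ, x + n * g.shift ∈ B := by
        intro n
        induction n with
        | zero => simpa using hx
        | succ n ih =>
          rw [← h]
          refine ⟨_, ih, ?_⟩
          simp only [hgx]
          push_cast
          ring
      have := hn ((y - x) / g.shift).val
      rw [ZMod.natCast_zmod_val, div_mul_cancel₀ _ hs] at this
      simpa using this
    · rintro (rfl | rfl) <;> simp
  rw [this, Nat.card_coe_set_eq, Set.ncard_pair Set.empty_ne_univ]

theorem fixedBy_prod_card {H X Y : Type*} [Group H] [MulAction H X] [MulAction H Y] (h : H) :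
    Nat.card (MulAction.fixedBy (X × Y) h) =
      Nat.card (MulAction.fixedBy X h) * Nat.card (MulAction.fixedBy Y h) := by
  rw [← Nat.card_prod]
  exact Nat.card_congr
    { toFun := fun z => (⟨z.1.1, congrArg Prod.fst z.2⟩, ⟨z.1.2, congrArg Prod.snd z.2⟩)
      invFun := fun z => ⟨(z.1.1, z.2.1), Prod.ext z.1.2 z.2.2⟩
      left_inv := fun _ => rfl
      right_inv := fun _ => rfl }

instance : Fintype (AffineMaps (ZMod p)) := Fintype.ofEquiv _ AffineMaps.equivProd.symm

theorem natCard_units_zmod : Nat.card (ZMod p)ˣ = p - 1 := by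
  rw [Nat.card_eq_fintype_card, ZMod.card_units]

/-- The number of orbits of the multiplicative group on sets of nonzero residues. -/
theorem card_orbits_units :
    (Nat.card (Quotient (MulAction.orbitRel (ZMod p)ˣ (Set (ZMod p)ˣ))) : ℚ) = circulantN p := by
  have h := congrArg (Nat.cast : ℕ → ℚ) (sum_card_fixedBy (ZMod p)ˣ (Set (ZMod p)ˣ))
  push_cast [card_fixedBy_set] at h
  rw [sum_orderOf_eq (fun d => (2 : ℚ) ^ (Nat.card (ZMod p)ˣ / d)), natCard_units_zmod] at h
  have hp := (Fact.out : p.Prime).one_lt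
  have hp1 : (p : ℚ) - 1 ≠ 0 := sub_ne_zero.mpr (by exact_mod_cast hp.ne')
  rw [circulantN, h, Nat.cast_sub hp.le]
  field_simp
  simp

/-- The number of orbits of the affine group on pairs of a set of nonzero residues and a set of
residues. -/
theorem card_orbits_affine :
    (Nat.card (Quotient (MulAction.orbitRel (AffineMaps (ZMod p))
      (Set (ZMod p)ˣ × Set (ZMod p)))) : ℚ) = totalN p := by
  have h := congrArg (Nat.cast : ℕ → ℚ)
    (sum_card_fixedBy (AffineMaps (ZMod p)) (Set (ZMod p)ˣ × Set (ZMod p)))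
  have hp := (Fact.out : p.Prime).one_lt
  have hp1 : (p : ℚ) - 1 ≠ 0 := sub_ne_zero.mpr (by exact_mod_cast hp.ne')
  have hp0 : (p : ℚ) ≠ 0 := by positivity
  have hcard : Nat.card (AffineMaps (ZMod p)) = (p - 1) * p := by
    rw [Nat.card_congr AffineMaps.equivProd, Nat.card_prod, natCard_units_zmod, Nat.card_zmod]
  have hF : ∀ a : (ZMod p)ˣ,
      Nat.card (MulAction.fixedBy (Set (ZMod p)ˣ) a) = 2 ^ ((p - 1) / orderOf a) := fun a => by
    rw [card_fixedBy_set, natCard_units_zmod]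
  -- The first term is the contribution of a slope a ≠ 1, extended to a = 1. The second corrects it
  -- there: the identity fixes 2^(p-1)·2^p pairs, each of the p - 1 translations 2^(p-1)·2. Divided
  -- by p(p - 1), it becomes the first term of `totalN`.
  have hinner : ∀ a : (ZMod p)ˣ, ∑ b : ZMod p, (Nat.card (MulAction.fixedBy
      (Set (ZMod p)ˣ × Set (ZMod p)) (⟨a, b⟩ : AffineMaps (ZMod p))) : ℚ) =
      2 * p * 2 ^ (2 * (p - 1) / orderOf a) +
        (if a = 1 then 2 ^ (p - 1) * (2 ^ p + 2 * (p - 1)) - 2 * p * 2 ^ (2 * (p - 1)) else 0 : ℚ) := by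
    intro a
    have hU : ∀ b : ZMod p, Nat.card (MulAction.fixedBy (Set (ZMod p)ˣ)
        (⟨a, b⟩ : AffineMaps (ZMod p))) = 2 ^ ((p - 1) / orderOf a) := fun b => hF a
    simp only [fixedBy_prod_card, hU]
    push_cast
    rw [← Finset.mul_sum]
    split_ifs with ha
    · subst ha
      have h0 : Nat.card (MulAction.fixedBy (Set (ZMod p)) (⟨1, 0⟩ : AffineMaps (ZMod p))) =
          2 ^ p := by
        have : MulAction.fixedBy (Set (ZMod p)) (1 : AffineMaps (ZMod p)) = Set.univ :=
          MulAction.fixedBy_one_eq_univ _ _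
        rw [← AffineMaps.one_def, this, Nat.card_coe_set_eq, Set.ncard_univ,
          Nat.card_eq_fintype_card, Fintype.card_set, ZMod.card]
      rw [← Finset.add_sum_erase _ _ (Finset.mem_univ (0 : ZMod p)), h0,
        Finset.sum_congr rfl (g := fun _ => (2 : ℚ)) fun b hb => by
          rw [card_fixedBy_translation rfl (Finset.ne_of_mem_erase hb)]; norm_num]
      rw [Finset.sum_const, Finset.card_erase_of_mem (Finset.mem_univ _), Finset.card_univ,
        ZMod.card, nsmul_eq_mul, Nat.cast_sub hp.le]
      simp
      ring
    · have hd : orderOf a ∣ p - 1 := natCard_units_zmod (p := p) ▸ orderOf_dvd_natCard a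
      rw [Finset.sum_congr rfl (g := fun _ => 2 * (2 : ℚ) ^ ((p - 1) / orderOf a)) fun b _ => by
          rw [card_fixedBy_homothety ha, hF]; push_cast; rfl]
      rw [Finset.sum_const, Finset.card_univ, ZMod.card, nsmul_eq_mul, Nat.mul_div_assoc _ hd]
      ring
  push_cast at h
  rw [← AffineMaps.equivProd.symm.sum_comp, Fintype.sum_prod_type] at h
  simp only [AffineMaps.equivProd, Equiv.coe_fn_symm_mk, hinner] at h
  rw [Finset.sum_add_distrib, Finset.sum_ite_eq', if_pos (Finset.mem_univ _), ← Finset.mul_sum,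
    sum_orderOf_eq (fun d => (2 : ℚ) ^ (2 * (p - 1) / d)), natCard_units_zmod, hcard] at h
  push_cast [Nat.cast_sub hp.le] at h
  rw [totalN, ← mul_left_inj' (mul_ne_zero hp1 hp0), ← h]
  obtain ⟨q, rfl⟩ : ∃ q, p = q + 1 := ⟨p - 1, by omega⟩
  simp only [Nat.add_sub_cancel] at *
  field_simp
  push_cast
  ring

/-! ### Dihedral digraphs -/

/-- The p-adic valuation of (2p)! is 2 plus that of 2!, which vanishes for odd p. -/
theorem not_pow_three_dvd_factorial (hp2 : p ≠ 2) : ¬ p ^ 3 ∣ (2 * p).factorial := by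
  have hp : p.Prime := Fact.out
  have h3 : 2 < p := lt_of_le_of_ne hp.two_le hp2.symm
  rw [padicValNat_dvd_iff_le (Nat.factorial_ne_zero _), mul_comm, padicValNat_factorial_mul,
    padicValNat.eq_zero_of_not_dvd (fun h => absurd ((hp.dvd_factorial).mp h) (by omega))]
  omega

/-- The set of rotations and reflections with the given parameters. -/
def dihedralSet (x : Set (ZMod p)ˣ × Set (ZMod p)) : Set (DihedralGroup p) :=
  {g | (∃ u ∈ x.1, g = .r (u : ZMod p)) ∨ ∃ b ∈ x.2, g = .sr b}

@[simp]
theorem r_mem_dihedralSet {x : Set (ZMod p)ˣ × Set (ZMod p)} {i : ZMod p} :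
    .r i ∈ dihedralSet x ↔ ∃ u ∈ x.1, i = (u : ZMod p) := by
  simp [dihedralSet]

theorem r_units_mem_dihedralSet {x : Set (ZMod p)ˣ × Set (ZMod p)} {u : (ZMod p)ˣ} :
    .r (u : ZMod p) ∈ dihedralSet x ↔ u ∈ x.1 := by
  simp [Units.val_inj]

@[simp]
theorem sr_mem_dihedralSet {x : Set (ZMod p)ˣ × Set (ZMod p)} {i : ZMod p} :
    .sr i ∈ dihedralSet x ↔ i ∈ x.2 := by
  simp [dihedralSet]

theorem one_notMem_dihedralSet (x : Set (ZMod p)ˣ × Set (ZMod p)) :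
    (1 : DihedralGroup p) ∉ dihedralSet x := by
  rw [DihedralGroup.one_def, r_mem_dihedralSet]
  rintro ⟨u, -, hu⟩
  exact u.ne_zero hu.symm

theorem range_dihedral : Set.range (fun x => Cay (dihedralSet x)) =
    cayleyDigraphs (DihedralGroup p) := by
  ext X
  constructor
  · rintro ⟨x, rfl⟩
    exact ⟨_, one_notMem_dihedralSet x, rfl⟩
  · rintro ⟨S, hS, rfl⟩
    refine ⟨({u | .r (u : ZMod p) ∈ S}, {b | .sr b ∈ S}), congrArg Cay ?_⟩
    ext (i | i)
    · rw [r_mem_dihedralSet]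
      constructor
      · rintro ⟨u, hu, rfl⟩
        exact hu
      · intro hi
        have h0 : i ≠ 0 := by
          rintro rfl
          exact hS hi
        exact ⟨Units.mk0 i h0, hi, rfl⟩
    · simp

/-- The automorphism of the dihedral group defined by an affine map. -/
def affineAut (g : AffineMaps (ZMod p)) : DihedralGroup p ≃* DihedralGroup p where
  toFun
    | .r i => .r (g.slope * i)
    | .sr i => .sr (g • i)
  invFun
    | .r i => .r (↑g.slope⁻¹ * i)
    | .sr i => .sr (g⁻¹ • i)
  left_inv
    | .r i => congrArg DihedralGroup.r (Units.inv_mul_cancel_left _ i)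
    | .sr i => congrArg DihedralGroup.sr (inv_smul_smul g i)
  right_inv
    | .r i => congrArg DihedralGroup.r (Units.mul_inv_cancel_left _ i)
    | .sr i => congrArg DihedralGroup.sr (smul_inv_smul g i)
  map_mul' := by
    rintro (i | i) (j | j) <;> simp [AffineMaps.smul_def] <;> ring

theorem cay_dihedralSet_relIso_smul (g : AffineMaps (ZMod p))
    (x : Set (ZMod p)ˣ × Set (ZMod p)) :
    Nonempty ((Cay (dihedralSet x)).Adj ≃r (Cay (dihedralSet (g • x))).Adj) := by
  refine nonempty_relIso_of_mulEquiv (affineAut g) ?_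
  rintro (i | i)
  · change DihedralGroup.r (g.slope * i : ZMod p) ∈ _ ↔ _
    rw [r_mem_dihedralSet, r_mem_dihedralSet]
    constructor
    · rintro ⟨_, ⟨u, hu, rfl⟩, h⟩
      refine ⟨u, hu, g.slope.isUnit.mul_left_cancel ?_⟩
      simpa [AffineMaps.smul_units_def] using h
    · rintro ⟨u, hu, rfl⟩
      exact ⟨g • u, Set.smul_mem_smul_set hu, by simp [AffineMaps.smul_units_def]⟩
  · change DihedralGroup.sr (g • i) ∈ _ ↔ _
    rw [sr_mem_dihedralSet, sr_mem_dihedralSet]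
    exact Set.smul_mem_smul_set_iff

theorem smul_set_eq_of_forall {H X : Type*} [Group H] [MulAction H X] {h : H} {s t : Set X}
    (hst : ∀ x, h • x ∈ t ↔ x ∈ s) : h • s = t := by
  ext x
  rw [Set.mem_smul_set_iff_inv_smul_mem, ← hst, smul_inv_smul]

theorem eq_mul_of_forall_add_one {F : ZMod p → ZMod p} {j : ZMod p}
    (h : ∀ k, F (k + 1) = F k + j) (k : ZMod p) : F k = F 0 + j * k := by
  have hn : ∀ n : ℕ, F n = F 0 + j * n := by
    intro n
    induction n with
    | zero => simp
    | succ n ih =>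
      push_cast
      rw [h, ih]
      ring
  simpa using hn k.val

/-- Isomorphic Cayley digraphs on the dihedral group of order `2p` are conjugate under its
automorphism group. -/
theorem exists_smul_eq_of_relIso_dihedral (hp2 : p ≠ 2) {x y : Set (ZMod p)ˣ × Set (ZMod p)}
    (e : Nonempty ((Cay (dihedralSet x)).Adj ≃r (Cay (dihedralSet y)).Adj)) :
    ∃ g : AffineMaps (ZMod p), g • x = y := by
  have hp : p.Prime := Fact.out
  have hnormal : (Subgroup.zpowers (.r 1 : DihedralGroup p)).Normal := by
    refine ⟨fun n hn g => ?_⟩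
    obtain ⟨k, rfl⟩ := Subgroup.mem_zpowers_iff.mp hn
    rcases g with i | i
    · exact Subgroup.mem_zpowers_iff.mpr ⟨k, by simp⟩
    · exact Subgroup.mem_zpowers_iff.mpr ⟨-k, by simp⟩
  obtain ⟨f, σ, hf1, hf, hσp, hfσ, hσ⟩ := exists_normalized_iso (p := p)
    (by rw [DihedralGroup.nat_card]; exact not_pow_three_dvd_factorial hp2)
    DihedralGroup.orderOf_r_one hnormal e
  have hσr : ∀ (v : DihedralGroup p) (k : ZMod p), σ (v * .r k) = σ v * .r k := by
    intro v k
    have hn : ∀ n : ℕ, σ (v * .r (n : ZMod p)) = σ v * .r (n : ZMod p) := by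
      intro n
      induction n with
      | zero => simp
      | succ n ih =>
        have hr : (.r ((n + 1 : ℕ) : ZMod p) : DihedralGroup p) = .r (n : ZMod p) * .r 1 := by simp
        rw [hr, ← mul_assoc, hσ, ih, mul_assoc]
    simpa using hn k.val
  have hσrot : ∀ k, σ (.r k) = σ (.r 0) * .r k := fun k => by simpa using hσr (.r 0) k
  have hσref : ∀ k, σ (.sr k) = σ (.sr 0) * .r k := fun k => by simpa using hσr (.sr 0) k
  -- Otherwise σ swaps rotations and reflections, and so does its odd power σ ^ p = 1.
  obtain ⟨i, hi⟩ : ∃ i, σ (.r 0) = .r i := by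
    rcases hm : σ (.r 0) with m | m
    · exact ⟨m, rfl⟩
    exfalso
    obtain ⟨n, hn⟩ : ∃ n, σ (.sr 0) = .r n := by
      rcases hn : σ (.sr 0) with n | n
      · exact ⟨n, rfl⟩
      have : σ (.r (n - m)) = σ (.sr 0) := by rw [hσrot, hm, hn]; simp
      cases σ.injective this
    have hsq : ∀ k : ℕ, ∃ l, (σ ^ (2 * k)) (.r 0) = .r l := by
      intro k
      induction k with
      | zero => exact ⟨0, rfl⟩
      | succ k ih =>
        obtain ⟨l, hl⟩ := ih
        refine ⟨n + (m + l), ?_⟩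
        rw [show 2 * (k + 1) = 1 + (1 + 2 * k) by ring, pow_add, pow_add, pow_one,
          Equiv.Perm.mul_apply, Equiv.Perm.mul_apply, hl, hσrot, hm, DihedralGroup.sr_mul_r,
          hσref, hn, DihedralGroup.r_mul_r]
    obtain ⟨k, hk⟩ := hp.odd_of_ne_two hp2
    obtain ⟨l, hl⟩ := hsq k
    have h1 : (σ ^ (2 * k + 1)) (.r 0) = .r 0 := by rw [← hk, hσp]; rfl
    rw [pow_succ', Equiv.Perm.mul_apply, hl, hσrot, hm] at h1
    cases h1
  obtain ⟨j, hj⟩ : ∃ j, σ (.sr 0) = .sr j := by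
    rcases hm : σ (.sr 0) with m | m
    · have : σ (.r (m - i)) = σ (.sr 0) := by rw [hσrot, hi, hm]; simp
      cases σ.injective this
    · exact ⟨m, rfl⟩
  have hσrot' : ∀ k, σ (.r k) = .r (k + i) := fun k => by rw [hσrot, hi]; simp [add_comm]
  have hσref' : ∀ k, σ (.sr k) = .sr (k + j) := fun k => by rw [hσref, hj]; simp [add_comm]
  have hfr : ∀ k, f (.r k) = .r (i * k) := by
    have hex : ∀ k : ℕ, f (.r (k : ZMod p)) = .r (i * k) := by
      intro k
      induction k with
      | zero => simpa using hf1
      | succ k ih =>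
        have := hfσ (.r (k : ZMod p))
        rw [DihedralGroup.r_mul_r, ih, hσrot'] at this
        push_cast
        rw [this, mul_add, mul_one]
    intro k
    simpa using hex k.val
  have hi0 : i ≠ 0 := by
    rintro rfl
    have : f (.r 1) = f (.r 0) := by rw [hfr, hfr]; simp
    exact one_ne_zero (DihedralGroup.r.inj (f.injective this))
  obtain ⟨c, hc⟩ : ∃ c, f (.sr 0) = .sr c := by
    rcases hc : f (.sr 0) with c | c
    · have : f (.r (i⁻¹ * c)) = f (.sr 0) := by rw [hfr, hc, mul_inv_cancel_left₀ hi0]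
      cases f.injective this
    · exact ⟨c, rfl⟩
  have hfs : ∀ k, f (.sr k) = .sr (c + j * k) := by
    have hex : ∀ k : ℕ, f (.sr (k : ZMod p)) = .sr (c + j * k) := by
      intro k
      induction k with
      | zero => simpa using hc
      | succ k ih =>
        have := hfσ (.sr (k : ZMod p))
        rw [DihedralGroup.sr_mul_r, ih, hσref'] at this
        push_cast
        rw [this, mul_add, mul_one, add_assoc]
    intro k
    simpa using hex k.val
  have hrot : ∀ k, .r (i * k) ∈ dihedralSet y ↔ .r k ∈ dihedralSet x := by
    intro k
    have := hf (.r 0) (.r k)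
    rw [hfr, hfr] at this
    simpa [Cay] using this
  have hA : ∀ g : AffineMaps (ZMod p), (g.slope : ZMod p) = i → g • x.1 = y.1 := by
    intro g hg
    refine smul_set_eq_of_forall fun u => ?_
    have := hrot u
    rw [r_units_mem_dihedralSet, ← hg, ← Units.val_mul, r_units_mem_dihedralSet] at this
    exact this
  -- Arcs from rotations to reflections.
  have href : ∀ k l, c + j * l - i * k ∈ y.2 ↔ l - k ∈ x.2 := by
    intro k l
    have := hf (.r k) (.sr l)
    rw [hfr, hfs] at this
    simp only [Cay, DihedralGroup.inv_r, DihedralGroup.sr_mul_r, sr_mem_dihedralSet] at this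
    simpa [sub_eq_add_neg] using this
  by_cases hij : j = i
  · subst hij
    refine ⟨⟨Units.mk0 j hi0, c⟩, Prod.ext (hA _ rfl) (smul_set_eq_of_forall fun b => ?_)⟩
    simpa [AffineMaps.smul_def, add_comm] using href 0 b
  · have hji : j - i ≠ 0 := sub_ne_zero.mpr hij
    -- For i ≠ j, the equations l - k = b and c + j l - i k = a are solvable for any a, b, with k =
    -- (a - c - j b) / (j - i).
    have hconst : ∀ a b, a ∈ y.2 ↔ b ∈ x.2 := by
      intro a b
      have := href ((a - c - j * b) / (j - i)) (b + (a - c - j * b) / (j - i))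
      rw [add_sub_cancel_right] at this
      rw [← this]
      have h : c + j * (b + (a - c - j * b) / (j - i)) - i * ((a - c - j * b) / (j - i)) = a := by
        field_simp
        ring
      rw [h]
    exact ⟨⟨Units.mk0 i hi0, 0⟩, Prod.ext (hA _ rfl) (smul_set_eq_of_forall fun b => hconst _ b)⟩

theorem relIso_dihedral_iff (hp2 : p ≠ 2) (x y : Set (ZMod p)ˣ × Set (ZMod p)) :
    Nonempty ((Cay (dihedralSet x)).Adj ≃r (Cay (dihedralSet y)).Adj) ↔
      MulAction.orbitRel (AffineMaps (ZMod p)) _ x y := by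
  constructor
  · rintro ⟨e⟩
    -- `orbitRel` asks for an element carrying the second argument to the first, hence the inverse
    -- isomorphism.
    exact exists_smul_eq_of_relIso_dihedral hp2 ⟨e.symm⟩
  · rintro ⟨g, rfl⟩
    obtain ⟨e⟩ := cay_dihedralSet_relIso_smul g y
    exact ⟨e.symm⟩

theorem countUpToIso_dihedral (hp2 : p ≠ 2) :
    (countUpToIso (cayleyDigraphs (DihedralGroup p)) : ℚ) = totalN p := by
  rw [← range_dihedral, countUpToIso_range _ _ (relIso_dihedral_iff hp2), card_orbits_affine]

/-! ### Circulant digraphs -/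

/-- The connection set of a circulant digraph with the given nonzero residues. -/
def circulantSet (A : Set (ZMod p)ˣ) : Set (Multiplicative (ZMod p)) :=
  {g | ∃ u ∈ A, g = .ofAdd (u : ZMod p)}

theorem ofAdd_units_mem_circulantSet {A : Set (ZMod p)ˣ} {u : (ZMod p)ˣ} :
    .ofAdd (u : ZMod p) ∈ circulantSet A ↔ u ∈ A := by
  simp [circulantSet, Units.val_inj]

theorem range_circulant : Set.range (fun A => Cay (circulantSet A)) =
    cayleyDigraphs (Multiplicative (ZMod p)) := by
  ext X
  constructor
  · rintro ⟨A, rfl⟩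
    refine ⟨_, ?_, rfl⟩
    rintro ⟨u, -, hu⟩
    exact u.ne_zero (Multiplicative.ofAdd.injective hu.symm)
  · rintro ⟨S, hS, rfl⟩
    refine ⟨{u | .ofAdd (u : ZMod p) ∈ S}, congrArg Cay ?_⟩
    ext g
    constructor
    · rintro ⟨u, hu, rfl⟩
      exact hu
    · intro hg
      have h0 : g.toAdd ≠ 0 := by
        intro h
        exact hS ((Multiplicative.toAdd.injective h : g = 1) ▸ hg)
      exact ⟨Units.mk0 _ h0, hg, rfl⟩

theorem cay_circulantSet_relIso_smul (a : (ZMod p)ˣ) (A : Set (ZMod p)ˣ) :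
    Nonempty ((Cay (circulantSet A)).Adj ≃r (Cay (circulantSet (a • A))).Adj) := by
  let φ : ZMod p ≃+ ZMod p := DistribMulAction.toAddEquiv (ZMod p) a
  refine nonempty_relIso_of_mulEquiv φ.toMultiplicative fun g => ?_
  have hφ : ∀ u : (ZMod p)ˣ, φ.toMultiplicative (.ofAdd (u : ZMod p)) =
    .ofAdd ((a • u : (ZMod p)ˣ) : ZMod p) := fun u => rfl
  constructor
  · rintro ⟨_, ⟨u, hu, rfl⟩, h⟩
    exact ⟨u, hu, φ.toMultiplicative.injective (h.trans (hφ u).symm)⟩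
  · rintro ⟨u, hu, rfl⟩
    exact ⟨a • u, Set.smul_mem_smul_set hu, hφ u⟩

/-- Isomorphic Cayley digraphs on the cyclic group of order `p` are conjugate under its
automorphism group. -/
theorem exists_smul_eq_of_relIso_circulant {A B : Set (ZMod p)ˣ}
    (e : Nonempty ((Cay (circulantSet A)).Adj ≃r (Cay (circulantSet B)).Adj)) :
    ∃ a : (ZMod p)ˣ, a • A = B := by
  have hord : orderOf (Multiplicative.ofAdd (1 : ZMod p)) = p := by
    rw [orderOf_ofAdd_eq_addOrderOf, ZMod.addOrderOf_one]
  have hfac : ¬ p ^ 3 ∣ (Nat.card (Multiplicative (ZMod p))).factorial := by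
    rw [Nat.card_eq_fintype_card, Fintype.card_multiplicative, ZMod.card,
      padicValNat_dvd_iff_le (Nat.factorial_ne_zero _)]
    have := padicValNat_factorial_mul 1 (p := p)
    rw [mul_one, Nat.factorial_one, padicValNat_one_right] at this
    omega
  obtain ⟨f, σ, hf1, hf, -, hfσ, hσ⟩ := exists_normalized_iso hfac hord inferInstance e
  -- Commuting with the translation by 1 makes σ a translation, so f has constant increments and is
  -- linear.
  have hσk := eq_mul_of_forall_add_one (F := fun k => (σ (.ofAdd k)).toAdd) (j := 1)
    fun k => congrArg Multiplicative.toAdd (hσ (.ofAdd k))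
  have hfk := eq_mul_of_forall_add_one (F := fun k => (f (.ofAdd k)).toAdd)
    (j := (σ (.ofAdd 0)).toAdd) fun k => by
      have h := hσk (f (.ofAdd k)).toAdd
      simp only [ofAdd_toAdd] at h
      rw [one_mul, add_comm] at h
      exact (congrArg Multiplicative.toAdd (hfσ (.ofAdd k))).trans h
  set i := (σ (.ofAdd 0)).toAdd
  have hf0 : (f (.ofAdd 0)).toAdd = 0 := congrArg Multiplicative.toAdd hf1
  have hfk' : ∀ k : ZMod p, f (.ofAdd k) = .ofAdd (i * k) := fun k => by
    have := hfk k
    rw [hf0, zero_add] at this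
    exact this
  have hi0 : i ≠ 0 := by
    intro hi
    have : f (.ofAdd 1) = f (.ofAdd 0) := by rw [hfk', hfk', hi, zero_mul, zero_mul]
    exact one_ne_zero (Multiplicative.ofAdd.injective (f.injective this))
  refine ⟨Units.mk0 i hi0, smul_set_eq_of_forall fun u => ?_⟩
  have h := hf 1 (.ofAdd (u : ZMod p))
  rw [hf1, hfk'] at h
  simp only [Cay, inv_one, mul_one] at h
  rwa [ofAdd_units_mem_circulantSet, ← Units.val_mk0 hi0, ← Units.val_mul,
    ofAdd_units_mem_circulantSet] at h

theorem countUpToIso_circulant :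
    (countUpToIso (cayleyDigraphs (Multiplicative (ZMod p))) : ℚ) = circulantN p := by
  rw [← range_circulant, countUpToIso_range _ (MulAction.orbitRel (ZMod p)ˣ _),
    card_orbits_units]
  intro A B
  constructor
  · rintro ⟨e⟩
    exact exists_smul_eq_of_relIso_circulant ⟨e.symm⟩
  · rintro ⟨a, rfl⟩
    obtain ⟨e⟩ := cay_circulantSet_relIso_smul a B
    exact ⟨e.symm⟩

/-! ### Connected dihedral digraphs -/

theorem not_isConnected_of_rotations (A : Set (ZMod p)ˣ) :
    ¬ IsConnected (Cay (dihedralSet (A, ∅))) := by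
  rw [isConnected_Cay_iff (one_notMem_dihedralSet _)]
  intro h
  have hle : Subgroup.closure (dihedralSet (A, ∅)) ≤ Subgroup.zpowers (.r 1) := by
    rw [Subgroup.closure_le]
    rintro (i | i) hi
    · exact Subgroup.mem_zpowers_iff.mpr ⟨i.val, by simp⟩
    · simp at hi
  have : (.sr 0 : DihedralGroup p) ∈ Subgroup.zpowers (.r 1) := hle (h ▸ Subgroup.mem_top _)
  obtain ⟨k, hk⟩ := Subgroup.mem_zpowers_iff.mp this
  simp at hk

theorem not_isConnected_of_reflection (b : ZMod p) :
    ¬ IsConnected (Cay (dihedralSet (∅, {b}))) := by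
  rw [isConnected_Cay_iff (one_notMem_dihedralSet _)]
  intro h
  have hS : dihedralSet (∅, {b}) = {(.sr b : DihedralGroup p)} := by
    ext (i | i) <;> simp
  rw [hS, ← Subgroup.zpowers_eq_closure] at h
  have hc := Nat.card_zpowers (.sr b : DihedralGroup p)
  rw [h, DihedralGroup.orderOf_sr, Subgroup.card_top, DihedralGroup.nat_card] at hc
  have := (Fact.out : p.Prime).one_lt
  omega

/-- A reflection and a nontrivial rotation generate D_{2p}, as p is prime. Without a rotation in the
set, the product of two distinct reflections supplies one. -/
theorem isConnected_dihedral {x : Set (ZMod p)ˣ × Set (ZMod p)} {b : ZMod p} (hb : b ∈ x.2)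
    (hx : ∀ b, x ≠ (∅, {b})) : IsConnected (Cay (dihedralSet x)) := by
  rw [isConnected_Cay_iff (one_notMem_dihedralSet _)]
  set H := Subgroup.closure (dihedralSet x)
  have hbH : .sr b ∈ H := Subgroup.subset_closure (sr_mem_dihedralSet.mpr hb)
  obtain ⟨k, hk0, hk⟩ : ∃ k : ZMod p, k ≠ 0 ∧ .r k ∈ H := by
    by_cases hA : x.1 = ∅
    · obtain ⟨c, hc, hcb⟩ : ∃ c ∈ x.2, c ≠ b := by
        by_contra! h
        exact hx b (Prod.ext hA (Set.eq_singleton_iff_unique_mem.mpr ⟨hb, h⟩))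
      refine ⟨c - b, sub_ne_zero.mpr hcb, ?_⟩
      have := mul_mem hbH (Subgroup.subset_closure (sr_mem_dihedralSet.mpr hc) : .sr c ∈ H)
      rwa [DihedralGroup.sr_mul_sr] at this
    · obtain ⟨u, hu⟩ := Set.nonempty_iff_ne_empty.mpr hA
      exact ⟨u, u.ne_zero, Subgroup.subset_closure (r_units_mem_dihedralSet.mpr hu)⟩
  have hr : ∀ i : ZMod p, .r i ∈ H := by
    intro i
    have := pow_mem hk (k⁻¹ * i).val
    rwa [DihedralGroup.r_pow, ZMod.natCast_zmod_val, mul_inv_cancel_left₀ hk0] at this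
  refine eq_top_iff.mpr ?_
  rintro (i | i) -
  · exact hr i
  · have := mul_mem hbH (hr (i - b))
    rwa [DihedralGroup.sr_mul_r, add_sub_cancel] at this

/-- Cayley digraphs on the dihedral group all of whose arcs come from rotations are counted by
circulant digraphs. -/
theorem countUpToIso_rotations (hp2 : p ≠ 2) :
    (countUpToIso (Set.range fun A : Set (ZMod p)ˣ => Cay (dihedralSet (p := p) (A, ∅))) : ℚ) =
      circulantN p := by
  rw [countUpToIso_range _ (MulAction.orbitRel (ZMod p)ˣ _), card_orbits_units]
  intro A B
  rw [relIso_dihedral_iff hp2]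
  constructor
  · rintro ⟨g, hg⟩
    exact ⟨g.slope, congrArg Prod.fst hg⟩
  · rintro ⟨a, rfl⟩
    exact ⟨⟨a, 0⟩, Prod.ext rfl Set.smul_set_empty⟩

theorem countUpToIso_connected (hp2 : p ≠ 2) :
    (countUpToIso {X ∈ cayleyDigraphs (DihedralGroup p) | IsConnected X} : ℚ) =
      totalN p - circulantN p - 1 := by
  let Q := Quotient.mk (isoSetoid (DihedralGroup p))
  let R : Set (Digraph (DihedralGroup p)) := Set.range fun A => Cay (dihedralSet (A, ∅))
  have : Finite (Digraph (DihedralGroup p)) :=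
    Finite.of_injective (fun X : Digraph (DihedralGroup p) => X.Adj) fun X Y h => Digraph.ext h
  have hdec : Q '' cayleyDigraphs (DihedralGroup p) =
      Q '' {X ∈ cayleyDigraphs (DihedralGroup p) | IsConnected X} ∪
        (Q '' R ∪ {Q (Cay (dihedralSet (∅, {0})))}) := by
    rw [← range_dihedral]
    ext q
    constructor
    · rintro ⟨_, ⟨x, rfl⟩, rfl⟩
      by_cases hx : ∃ b, x = (∅, {b})
      · obtain ⟨b, rfl⟩ := hx
        refine Or.inr (Or.inr (Quotient.sound ?_))
        refine (relIso_dihedral_iff hp2 _ _).mpr ⟨⟨1, b⟩, Prod.ext Set.smul_set_empty ?_⟩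
        simp [AffineMaps.smul_def]
      · rcases Set.eq_empty_or_nonempty x.2 with h | ⟨b, hb⟩
        · exact Or.inr (Or.inl ⟨_, ⟨x.1, rfl⟩, by rw [← h]⟩)
        · exact Or.inl ⟨_, ⟨⟨x, rfl⟩, isConnected_dihedral hb fun b h => hx ⟨b, h⟩⟩, rfl⟩
    · rintro (⟨X, ⟨hX, -⟩, rfl⟩ | ⟨_, ⟨A, rfl⟩, rfl⟩ | rfl)
      · exact ⟨X, hX, rfl⟩
      · exact ⟨_, ⟨_, rfl⟩, rfl⟩
      · exact ⟨_, ⟨_, rfl⟩, rfl⟩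
  -- Affine maps keep an empty set of reflections empty.
  have hdisj1 : Disjoint (Q '' R) {Q (Cay (dihedralSet (∅, {0})))} := by
    rw [Set.disjoint_singleton_right]
    rintro ⟨_, ⟨A, rfl⟩, h⟩
    obtain ⟨g, hg⟩ := (relIso_dihedral_iff hp2 _ _).mp (Quotient.exact h)
    have := congrArg Prod.snd hg
    simp at this
  have hdisj2 : Disjoint (Q '' {X ∈ cayleyDigraphs (DihedralGroup p) | IsConnected X})
      (Q '' R ∪ {Q (Cay (dihedralSet (∅, {0})))}) := by
    rw [Set.disjoint_left]
    rintro _ ⟨X, ⟨-, hX⟩, rfl⟩ (⟨_, ⟨A, rfl⟩, h⟩ | h)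
    · obtain ⟨e⟩ := Quotient.exact h
      exact not_isConnected_of_rotations A (hX.of_relIso e.symm)
    · obtain ⟨e⟩ := Quotient.exact h
      exact not_isConnected_of_reflection 0 (hX.of_relIso e)
  have h := congrArg Set.ncard hdec
  rw [Set.ncard_union_eq hdisj2 (Set.toFinite _) (Set.toFinite _),
    Set.ncard_union_eq hdisj1 (Set.toFinite _) (Set.toFinite _), Set.ncard_singleton] at h
  rw [← countUpToIso_dihedral hp2, ← countUpToIso_rotations hp2]
  have h' : countUpToIso (cayleyDigraphs (DihedralGroup p)) =
    countUpToIso {X ∈ cayleyDigraphs (DihedralGroup p) | IsConnected X} +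
      (countUpToIso R + 1) := h
  rw [h']
  push_cast
  ring

end CayleyEnum

theorem mainTheorem4 (p : ℕ) (hp : p.Prime) (hp2 : p ≠ 2) :
    (CayleyEnum.countUpToIso
        {X ∈ CayleyEnum.cayleyDigraphs (DihedralGroup p) | CayleyEnum.IsConnected X} : ℚ) =
      CayleyEnum.totalN p - CayleyEnum.circulantN p - 1 ∧
    (CayleyEnum.countUpToIso (CayleyEnum.cayleyDigraphs (DihedralGroup p)) : ℚ) =
      CayleyEnum.totalN p ∧
    (CayleyEnum.countUpToIso (CayleyEnum.cayleyDigraphs (Multiplicative (ZMod p))) : ℚ) =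
      CayleyEnum.circulantN p := by
  have : Fact p.Prime := ⟨hp⟩
  exact ⟨CayleyEnum.countUpToIso_connected hp2, CayleyEnum.countUpToIso_dihedral hp2,
    CayleyEnum.countUpToIso_circulant⟩
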